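/- Let $\mathbb{K}$ be a field of characteristic $0$, with algebraic closure $\overline{\mathbb{K}}$, and let $\Delta(t,u)\in\mathbb{K}[[t]][u]$ be non-zero. Then $\Delta$ admits a factorization $$ \Delta(t,u)= c\, t^{p} \bigl(1+tS(t)\bigr) \bigl(1+tuR_1(t,u)\bigr) \bigl(u^d+tR_2(t,u)\bigr) \prod_{i=1}^k \left( \left(1-\frac{u}{\alpha_i}\right)^{d_i}+tuQ_i(t,u)\right), $$ where - $p,d,k$ are nonnegative integers and $d_1,\dots,d_k$ are positive integers, - $c\in\mathbb{K}$, and $\alpha_1,\dots,\alpha_k$ are distinct non-zero elements of $\overline{\mathbb{K}}$, - $S(t)\in\mathbb{K}[[t]]$, - $R_1(t,u)$ and $R_2(t,u)$ belong to $\mathbb{K}[[t]][u]$, with $\deg_u R_2<d$, - $Q_i(t,u)\in\overline{\mathbb{K}}[[t]][u]$, with $\deg_u Q_i<d_i$ (the zero polynomial has degree $-\infty$, and the identity holds in $\overline{\mathbb{K}}[[t]][u]$). This factorization is unique: any two of them have the same $c,p,S,R_1,d,R_2$ and $k$, and the same triples $(\alpha_i,d_i,Q_i)$ up to the order of the indices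 $i$. Moreover, consider roots in $u$, counted with multiplicity, in the field of Puiseux series $U=\sum_{n\ge n_0}a_n t^{n/m}$ ($n_0\in\mathbb{Z}$, $m\ge 1$, $a_n\in\overline{\mathbb{K}}$). Say that $U$ is infinite at $t=0$ if it contains a negative power of $t$; otherwise it is finite at $t=0$, and its value there is its constant coefficient. Then the roots of $\Delta$ that are infinite (resp. zero, finite and non-zero) at $t=0$ are exactly the roots of $1+tuR_1$ (resp. of $u^d+tR_2$, of the product over $i$); and for each $i$, the roots of $\Delta$ that equal $\alpha_i$ at $t=0$ are exactly the roots of the $i$-th factor $(1-u/\alpha_i)^{d_i}+tuQ_i$. -/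

import Mathlib

open scoped Polynomial PowerSeries HahnSeries

/-- The exponents occurring in `x` all lie in `(1/d)ℤ`. -/
def HasDenominator {L : Type*} [Field L] (d : ℕ) (x : L⟦ℚ⟧) : Prop :=
  ∀ q ∈ x.support, ∃ n : ℤ, q = (n : ℚ) / (d : ℚ)

/-- The order-preserving ring embedding of `L((t))` given by `t ↦ t^(1/d)`. -/
noncomputable def stretch (L : Type*) [Field L] (d : ℕ) (hd : 0 < d) : L⟦ℤ⟧ →+* L⟦ℚ⟧ :=
  HahnSeries.embDomainRingHom
    ((AddMonoidHom.mulRight ((d : ℚ)⁻¹)).comp (Int.castAddHom ℚ))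
    (fun a b h => by
      have hd' : (d : ℚ)⁻¹ ≠ 0 := by positivity
      simpa [hd'] using (mul_right_cancel₀ hd' (by simpa using h) : (a : ℚ) = b))
    (fun a b => by
      have hd' : (0 : ℚ) < (d : ℚ)⁻¹ := by positivity
      simp [mul_le_mul_iff_left₀ hd'])

theorem stretch_coeff {L : Type*} [Field L] (d : ℕ) (hd : 0 < d) (y : L⟦ℤ⟧) (n : ℤ) :
    (stretch L d hd y).coeff ((n : ℚ) / (d : ℚ)) = y.coeff n := by
  rw [div_eq_mul_inv]
  exact HahnSeries.embDomain_coeff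

theorem hasDenominator_stretch {L : Type*} [Field L] (d : ℕ) (hd : 0 < d) (y : L⟦ℤ⟧) :
    HasDenominator d (stretch L d hd y) := by
  intro q hq
  obtain ⟨n, -, rfl⟩ := HahnSeries.support_embDomain_subset hq
  exact ⟨n, by simp [div_eq_mul_inv]⟩

theorem HasDenominator.exists_stretch {L : Type*} [Field L] {d : ℕ} (hd : 0 < d) {x : L⟦ℚ⟧}
    (hx : HasDenominator d x) : ∃ y : L⟦ℤ⟧, stretch L d hd y = x := by
  have hd' : (0 : ℚ) < d := by exact_mod_cast hd
  have hmono : StrictMono (fun n : ℤ => (n : ℚ) / d) := fun a b h => by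
    have : (a : ℚ) < b := by exact_mod_cast h
    exact div_lt_div_of_pos_right this hd'
  have hpwo : (Function.support fun n : ℤ => x.coeff ((n : ℚ) / d)).IsPWO := by
    rw [Set.isPWO_iff_isWF, Set.isWF_iff_no_descending_seq]
    intro f hf hmem
    refine (Set.isWF_iff_no_descending_seq.1 (Set.isPWO_iff_isWF.1 x.isPWO_support))
      (fun k => (f k : ℚ) / d) (fun a b h => hmono (hf h)) ?_
    exact fun k => hmem k
  refine ⟨⟨fun n => x.coeff ((n : ℚ) / d), hpwo⟩, ?_⟩
  ext q
  by_cases hq : ∃ n : ℤ, q = (n : ℚ) / d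
  · obtain ⟨n, rfl⟩ := hq
    exact stretch_coeff d hd _ n
  · have h1 : x.coeff q = 0 := by
      by_contra h
      exact hq (hx q h)
    have h2 := mt (hasDenominator_stretch d hd ⟨fun n => x.coeff ((n : ℚ) / d), hpwo⟩ q) hq
    rw [h1]
    simpa using h2

theorem HasDenominator.mono {L : Type*} [Field L] {d e : ℕ} (he : 0 < e) {x : L⟦ℚ⟧}
    (hx : HasDenominator d x) (hd : 0 < d) : HasDenominator (d * e) x := by
  intro q hq
  obtain ⟨n, rfl⟩ := hx q hq
  refine ⟨n * e, ?_⟩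
  have h1 : (d : ℚ) ≠ 0 := by positivity
  have h2 : (e : ℚ) ≠ 0 := by positivity
  push_cast
  field_simp

theorem exists_common_stretch {L : Type*} [Field L] {x y : L⟦ℚ⟧}
    (hx : ∃ d : ℕ, 0 < d ∧ HasDenominator d x) (hy : ∃ d : ℕ, 0 < d ∧ HasDenominator d y) :
    ∃ (d : ℕ) (hd : 0 < d) (x' y' : L⟦ℤ⟧), stretch L d hd x' = x ∧ stretch L d hd y' = y := by
  obtain ⟨d, hd, hx⟩ := hx
  obtain ⟨e, he, hy⟩ := hy
  have hde : 0 < d * e := Nat.mul_pos hd he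
  obtain ⟨x', hx'⟩ := (hx.mono he hd).exists_stretch hde
  have hy2 : HasDenominator (d * e) y := by
    rw [mul_comm]
    exact hy.mono hd he
  obtain ⟨y', hy'⟩ := hy2.exists_stretch hde
  exact ⟨d * e, hde, x', y', hx', hy'⟩

/-- The field of Puiseux series (fractional Laurent series) in `t` over `L`: the series
`∑_{n ≥ n₀} a_n t^(n/d)` with `n₀ ∈ ℤ` and `d` a positive integer.  A well-ordered set of rational
exponents with a common denominator `d` is bounded below, so these are exactly the Hahn series
with exponents in `ℚ` whose exponents have a common denominator. -/
noncomputable def PuiseuxSeries (L : Type*) [Field L] : Subfield L⟦ℚ⟧ where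
  carrier := {x | ∃ d : ℕ, 0 < d ∧ HasDenominator d x}
  mul_mem' := by
    intro x y hx hy
    obtain ⟨d, hd, x', y', rfl, rfl⟩ := exists_common_stretch hx hy
    exact ⟨d, hd, by rw [← map_mul]; exact hasDenominator_stretch d hd _⟩
  one_mem' := ⟨1, one_pos, by rw [← map_one (stretch L 1 one_pos)]; exact hasDenominator_stretch _ _ _⟩
  add_mem' := by
    intro x y hx hy
    obtain ⟨d, hd, x', y', rfl, rfl⟩ := exists_common_stretch hx hy
    exact ⟨d, hd, by rw [← map_add]; exact hasDenominator_stretch d hd _⟩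
  zero_mem' := ⟨1, one_pos, by rw [← map_zero (stretch L 1 one_pos)]; exact hasDenominator_stretch _ _ _⟩
  neg_mem' := by
    intro x hx
    obtain ⟨d, hd, hx⟩ := hx
    obtain ⟨x', rfl⟩ := hx.exists_stretch hd
    exact ⟨d, hd, by rw [← map_neg]; exact hasDenominator_stretch d hd _⟩
  inv_mem' := by
    intro x hx
    obtain ⟨d, hd, hx⟩ := hx
    obtain ⟨x', rfl⟩ := hx.exists_stretch hd
    exact ⟨d, hd, by rw [← map_inv₀]; exact hasDenominator_stretch d hd _⟩

/-- The inclusion of `L[[t]]` into the field of Puiseux series over `L`. -/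
noncomputable def powerSeriesToPuiseux (L : Type*) [Field L] : L⟦X⟧ →+* PuiseuxSeries L :=
  (HahnSeries.ofPowerSeries ℚ L).codRestrict (PuiseuxSeries L) (by
    intro f
    refine ⟨1, one_pos, fun q hq => ?_⟩
    rw [HahnSeries.ofPowerSeries_apply] at hq
    obtain ⟨n, -, rfl⟩ := HahnSeries.support_embDomain_subset hq
    exact ⟨n, by simp⟩)

namespace PuiseuxSeries

variable {L : Type*} [Field L]

/-- `U` is finite at `t = 0`: no negative power of `t` occurs in `U`. -/
def IsFiniteAtZero (U : PuiseuxSeries L) : Prop :=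
  ∀ q : ℚ, q < 0 → (U : L⟦ℚ⟧).coeff q = 0

/-- `U` is infinite at `t = 0`: some negative power of `t` occurs in `U`. -/
def IsInfiniteAtZero (U : PuiseuxSeries L) : Prop :=
  ∃ q : ℚ, q < 0 ∧ (U : L⟦ℚ⟧).coeff q ≠ 0

/-- `U` is finite at `t = 0`, and equal to `a` there. -/
def IsEqualAtZero (a : L) (U : PuiseuxSeries L) : Prop :=
  IsFiniteAtZero U ∧ (U : L⟦ℚ⟧).coeff 0 = a

/-- `U` is finite and non-zero at `t = 0`. -/
def IsFiniteNonzeroAtZero (U : PuiseuxSeries L) : Prop :=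
  IsFiniteAtZero U ∧ (U : L⟦ℚ⟧).coeff 0 ≠ 0

end PuiseuxSeries

/-- The roots of `P ∈ L[[t]][u]` among the Puiseux series over `L`, with multiplicities. -/
noncomputable def puiseuxRoots {L : Type*} [Field L] (P : L⟦X⟧[X]) :
    Multiset (PuiseuxSeries L) :=
  (P.map (powerSeriesToPuiseux L)).roots

open Classical in
/-- The Puiseux roots of `P`, with multiplicities, that have the property `p`. -/
noncomputable def puiseuxRootsWith {L : Type*} [Field L] (p : PuiseuxSeries L → Prop)
    (P : L⟦X⟧[X]) : Multiset (PuiseuxSeries L) :=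
  (puiseuxRoots P).filter p

/-- Extension of scalars `K[[t]][u] → L[[t]][u]`. -/
noncomputable def extendScalars {K : Type*} (L : Type*) [Field K] [Field L] [Algebra K L] :
    K⟦X⟧[X] →+* L⟦X⟧[X] :=
  Polynomial.mapRingHom (PowerSeries.map (algebraMap K L))

/-- The series `t`, as an element of `F[[t]][u]`. -/
noncomputable def tVar (F : Type*) [Field F] : F⟦X⟧[X] := Polynomial.C PowerSeries.X

/-- The variable `u` of `F[[t]][u]`. -/
noncomputable def uVar (F : Type*) [Field F] : F⟦X⟧[X] := Polynomial.X

/-- The constant `a ∈ F`, as an element of `F[[t]][u]`. -/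
noncomputable def constant {F : Type*} [Field F] (a : F) : F⟦X⟧[X] :=
  Polynomial.C (PowerSeries.C a)

/-- The parameters `c, p, S, R₁, d, R₂, k, (αᵢ), (dᵢ), (Qᵢ)` of a canonical factorization;
`dᵢ` is called `e i`. -/
structure FactorizationData (K L : Type*) [Field K] [Field L] where
  c : K
  p : ℕ
  S : K⟦X⟧
  R₁ : K⟦X⟧[X]
  d : ℕ
  R₂ : K⟦X⟧[X]
  k : ℕ
  α : Fin k → L
  e : Fin k → ℕ
  Q : Fin k → L⟦X⟧[X]

namespace FactorizationData

variable {K L : Type*} [Field K] [Field L]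

/-- `c t^p (1 + t S(t))` -/
noncomputable def unitPart (D : FactorizationData K L) : K⟦X⟧[X] :=
  constant D.c * tVar K ^ D.p * (1 + tVar K * Polynomial.C D.S)

/-- `1 + t u R₁(t,u)` -/
noncomputable def infiniteFactor (D : FactorizationData K L) : K⟦X⟧[X] :=
  1 + tVar K * uVar K * D.R₁

/-- `u^d + t R₂(t,u)` -/
noncomputable def zeroFactor (D : FactorizationData K L) : K⟦X⟧[X] :=
  uVar K ^ D.d + tVar K * D.R₂

/-- `(1 - u/αᵢ)^{dᵢ} + t u Qᵢ(t,u)` -/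
noncomputable def finiteFactor (D : FactorizationData K L) (i : Fin D.k) : L⟦X⟧[X] :=
  (1 - constant (D.α i)⁻¹ * uVar L) ^ D.e i + tVar L * uVar L * D.Q i

/-- `D` is a canonical factorization of `Δ`.  The equality is read in `L[[t]][u]`, where the
`Qᵢ` live.  Degrees are such that the zero polynomial has degree `⊥`, below every integer. -/
structure IsFactorizationOf [Algebra K L] (D : FactorizationData K L) (Δ : K⟦X⟧[X]) : Prop where
  degree_R₂ : D.R₂.degree < D.d
  α_ne_zero : ∀ i, D.α i ≠ 0
  α_injective : Function.Injective D.α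
  e_pos : ∀ i, 0 < D.e i
  degree_Q : ∀ i, (D.Q i).degree < D.e i
  eq : extendScalars L Δ =
    extendScalars L D.unitPart * extendScalars L D.infiniteFactor *
      extendScalars L D.zeroFactor * ∏ i, D.finiteFactor i

/-- Two sets of parameters agree, up to a renumbering of the triples `(αᵢ, dᵢ, Qᵢ)`. -/
def Equivalent (D D' : FactorizationData K L) : Prop :=
  D.c = D'.c ∧ D.p = D'.p ∧ D.S = D'.S ∧ D.R₁ = D'.R₁ ∧ D.d = D'.d ∧ D.R₂ = D'.R₂ ∧
    ∃ σ : Fin D.k ≃ Fin D'.k, ∀ i,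
      D.α i = D'.α (σ i) ∧ D.e i = D'.e (σ i) ∧ D.Q i = D'.Q (σ i)

end FactorizationData

/-! Removing the largest power of `t` leaves a polynomial whose reduction modulo `t` is nonzero,
hence equal over `L` to `c u^d ∏ (1 - u/αᵢ)^{dᵢ}` with pairwise coprime factors. Hensel's lemma
(`exists_hensel_lift` and its variants) lifts these factors. Any excess of the `u`-degree over the
degree of the reduction goes into a factor that reduces to `1`, namely `1 + tuR₁`. Splitting off
`u^d` and this excess is done over `K`; only the separation of the `αᵢ` needs `L`.

Uniqueness: the power of `t` and the reduction determine `p`, `c`, `d` and the pairs `(αᵢ, dᵢ)`. If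
two lifts of one factor differed, the lowest `t`-coefficient of their difference would, after
removal of a factor coprime to the reduced factor, be divisible by that reduced factor, against the
degree bounds (`eq_zero_of_mul_eq_mul`). Cancelling the lifted factors leaves `c(1+tS)(1+tuR₁)`,
whose constant term in `u` separates the two parts.

Roots: the value at `t = 0` of a finite root is a root of the reduction (`eval_finite`), so `1 +
tuR₁` has no finite root. If reduction preserves the degree, passing to the reversed polynomial
excludes infinite roots. Hence all roots of a given factor have the announced behaviour, and
additivity of root multisets under products concludes. -/

/-- Reduction modulo `t`, from `F[[t]][u]` to `F[u]`. -/
noncomputable def reduction (F : Type*) [Field F] : F⟦X⟧[X] →+* F[X] :=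
  Polynomial.mapRingHom PowerSeries.constantCoeff

/-- The embedding of `F[[t]][u]` into `F[u][[t]]`. -/
noncomputable def swapVars (F : Type*) [Field F] : F⟦X⟧[X] →+* F[X]⟦X⟧ :=
  Polynomial.eval₂RingHom (PowerSeries.map Polynomial.C) (PowerSeries.C Polynomial.X)

/-! ### Hensel's lemma in `F[[t]][u]` -/

section Hensel

variable {F : Type*} [Field F]

theorem reduction_coeff (P : F⟦X⟧[X]) (j : ℕ) :
    (reduction F P).coeff j = PowerSeries.constantCoeff (P.coeff j) := by
  simp [reduction]

theorem swapVars_coeff (P : F⟦X⟧[X]) (n j : ℕ) :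
    (PowerSeries.coeff n (swapVars F P)).coeff j = PowerSeries.coeff n (P.coeff j) := by
  induction P using Polynomial.induction_on' with
  | add p q hp hq => simp [hp, hq]
  | monomial k a =>
    simp only [swapVars, Polynomial.coe_eval₂RingHom, Polynomial.eval₂_monomial, ← map_pow,
      PowerSeries.coeff_mul_C, PowerSeries.coeff_map, Polynomial.coeff_C_mul,
      Polynomial.coeff_X_pow, Polynomial.coeff_monomial]
    by_cases h : j = k
    · simp [h]
    · simp [h, Ne.symm h]

theorem swapVars_injective : Function.Injective (swapVars F) := by
  intro P Q h
  ext j n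
  rw [← swapVars_coeff, h, swapVars_coeff]

theorem constantCoeff_swapVars (P : F⟦X⟧[X]) :
    PowerSeries.constantCoeff (swapVars F P) = reduction F P := by
  ext j
  rw [reduction_coeff, ← PowerSeries.coeff_zero_eq_constantCoeff_apply, swapVars_coeff,
    PowerSeries.coeff_zero_eq_constantCoeff_apply]

theorem natDegree_coeff_swapVars_le (P : F⟦X⟧[X]) (n : ℕ) :
    (PowerSeries.coeff n (swapVars F P)).natDegree ≤ P.natDegree := by
  rw [Polynomial.natDegree_le_iff_coeff_eq_zero]
  intro j hj
  rw [swapVars_coeff, Polynomial.coeff_eq_zero_of_natDegree_lt hj, map_zero]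

/-- A series in `F[u][[t]]` need not be polynomial in `u`; a uniform degree bound is what brings
Hensel's coefficientwise construction back to `F[[t]][u]`. -/
theorem exists_swapVars_eq (N : ℕ) (f : F[X]⟦X⟧)
    (hf : ∀ n, (PowerSeries.coeff n f).natDegree ≤ N) :
    ∃ P : F⟦X⟧[X], P.natDegree ≤ N ∧ swapVars F P = f := by
  let a : ℕ → F⟦X⟧ := fun j => PowerSeries.mk fun n => (PowerSeries.coeff n f).coeff j
  have hc : ∀ j, (∑ i ∈ Finset.range (N + 1), Polynomial.monomial i (a i)).coeff j =
      if j ≤ N then a j else 0 := by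
    intro j
    simp [Polynomial.finsetSum_coeff, Polynomial.coeff_monomial]
  refine ⟨∑ i ∈ Finset.range (N + 1), Polynomial.monomial i (a i), ?_, ?_⟩
  · rw [Polynomial.natDegree_le_iff_coeff_eq_zero]
    intro j hj
    rw [hc, if_neg (by omega)]
  · ext n j
    rw [swapVars_coeff, hc]
    split_ifs with h
    · simp [a]
    · rw [map_zero, Polynomial.coeff_eq_zero_of_natDegree_lt ((hf n).trans_lt (by omega))]

/-- Bézout coefficients are corrected by Euclidean division by the monic `g`. The bound on the
second unknown follows from `g * b = r - a * h`; it keeps the `u`-degree of the lifted cofactor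
bounded. -/
theorem exists_bezout_natDegree_le {g h : F[X]} (hg : g.Monic) (hgh : IsCoprime g h)
    (r : F[X]) :
    ∃ ab : F[X] × F[X], g * ab.2 + ab.1 * h = r ∧ ab.1.degree < g.degree ∧
      ∀ N, r.natDegree ≤ N → g.natDegree + h.natDegree ≤ N →
        g.natDegree + ab.2.natDegree ≤ N := by
  obtain ⟨u, v, huv⟩ := hgh
  have heq : g * (r * u + (r * v /ₘ g) * h) + (r * v %ₘ g) * h = r := by
    have h1 := Polynomial.modByMonic_add_div (r * v) g
    linear_combination h * h1 + r * huv
  have hdeg := Polynomial.degree_modByMonic_lt (r * v) hg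
  refine ⟨(r * v %ₘ g, r * u + (r * v /ₘ g) * h), heq, hdeg, fun N hr hN => ?_⟩
  set b := r * u + (r * v /ₘ g) * h
  set a := r * v %ₘ g
  change g.natDegree + b.natDegree ≤ N
  by_cases hb : b = 0
  · simp only [hb, Polynomial.natDegree_zero]; omega
  rw [← hg.natDegree_mul' hb, show g * b = r - a * h by linear_combination heq]
  refine (Polynomial.natDegree_sub_le _ _).trans (max_le hr ?_)
  have h2 : a.natDegree ≤ g.natDegree := Polynomial.natDegree_le_natDegree hdeg.le
  exact Polynomial.natDegree_mul_le.trans (by omega)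

/-- The coefficients of the two factors in Hensel's lemma, where `sol` solves the linearized
equation. -/
noncomputable def henselCoeff {B : Type*} [CommRing B] (sol : B → B × B) (P : ℕ → B) (g h : B) :
    ℕ → B × B
  | 0 => (g, h)
  | n + 1 => sol (P (n + 1) - ∑ i : Fin n,
      (henselCoeff sol P g h (i + 1)).1 * (henselCoeff sol P g h (n - i)).2)
termination_by n => n

theorem mk_mul_mk_henselCoeff {B : Type*} [CommRing B] (sol : B → B × B) (P : B⟦X⟧) (g h : B)
    (h0 : PowerSeries.constantCoeff P = g * h)
    (hsol : ∀ r, g * (sol r).2 + (sol r).1 * h = r) :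
    PowerSeries.mk (fun n => (henselCoeff sol (fun m => PowerSeries.coeff m P) g h n).1) *
      PowerSeries.mk (fun n => (henselCoeff sol (fun m => PowerSeries.coeff m P) g h n).2) = P := by
  set f := henselCoeff sol (fun m => PowerSeries.coeff m P) g h with hf
  have hf0 : f 0 = (g, h) := by rw [hf, henselCoeff]
  ext n
  rw [PowerSeries.coeff_mul]
  simp only [PowerSeries.coeff_mk]
  cases n with
  | zero => simp [hf0, h0]
  | succ n =>
    have hs := hsol (PowerSeries.coeff (n + 1) P - ∑ i : Fin n, (f (i + 1)).1 * (f (n - i)).2)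
    have hfs : f (n + 1) = sol (PowerSeries.coeff (n + 1) P -
        ∑ i : Fin n, (f (i + 1)).1 * (f (n - i)).2) := by
      rw [hf, henselCoeff]
    rw [← hfs] at hs
    -- The two extreme terms of the convolution contain the new unknowns linearly; the middle terms
    -- are those subtracted in the recursion.
    rw [Finset.Nat.sum_antidiagonal_eq_sum_range_succ (fun i j => (f i).1 * (f j).2),
      Finset.sum_range_succ, Finset.sum_range_succ', Nat.sub_self, Nat.sub_zero, hf0,
      Finset.sum_range]
    simp only [Nat.add_sub_add_right]
    linear_combination hs

/-- **Hensel's lemma**: a factorization modulo `t` into coprime factors, one of which is monic,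
lifts. -/
theorem exists_hensel_lift (P : F⟦X⟧[X]) {g h : F[X]} (hg : g.Monic) (hgh : IsCoprime g h)
    (hP : reduction F P = g * h) :
    ∃ G H : F⟦X⟧[X], P = G * H ∧ G.Monic ∧ reduction F G = g ∧ reduction F H = h := by
  choose sol hsol hdeg hN using exists_bezout_natDegree_le hg hgh
  set N := P.natDegree with hNdef
  set f := henselCoeff sol (fun m => PowerSeries.coeff m (swapVars F P)) g h with hf
  have hf0 : f 0 = (g, h) := by rw [hf, henselCoeff]
  have hfs : ∀ n, f (n + 1) = sol (PowerSeries.coeff (n + 1) (swapVars F P) -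
        ∑ i : Fin n, (f (i + 1)).1 * (f (n - i)).2) := by
    intro n
    rw [hf, henselCoeff]
  have hmul := mk_mul_mk_henselCoeff sol (swapVars F P) g h
    ((constantCoeff_swapVars P).trans hP) hsol
  rw [← hf] at hmul
  have hdeg1 : ∀ n, (f (n + 1)).1.degree < g.degree := fun n => by rw [hfs]; exact hdeg _
  have hdeg1' : ∀ n, (f n).1.natDegree ≤ g.natDegree := by
    intro n
    cases n with
    | zero => rw [hf0]
    | succ n => exact Polynomial.natDegree_le_natDegree (hdeg1 n).le
  have hghN : g.natDegree + h.natDegree ≤ N := by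
    -- If `h = 0`, coprimality makes `g` a unit, so both degrees are zero.
    by_cases hh : h = 0
    · rw [hh, isCoprime_zero_right] at hgh
      simp [hh, Polynomial.natDegree_eq_zero_of_isUnit hgh]
    · rw [← hg.natDegree_mul' hh, ← hP, reduction, Polynomial.coe_mapRingHom]
      exact Polynomial.natDegree_map_le
  have hdeg2 : ∀ n, g.natDegree + (f n).2.natDegree ≤ N := by
    intro n
    induction n using Nat.strong_induction_on with
    | _ n ih =>
      cases n with
      | zero => rw [hf0]; exact hghN
      | succ n =>
        rw [hfs]
        refine hN _ N ?_ hghN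
        refine (Polynomial.natDegree_sub_le _ _).trans
          (max_le (natDegree_coeff_swapVars_le P _) ?_)
        refine Polynomial.natDegree_sum_le_of_forall_le _ _ fun i _ => ?_
        have h1 := hdeg1' (i + 1)
        have h2 := ih (n - i) (by omega)
        exact Polynomial.natDegree_mul_le.trans (by omega)
  obtain ⟨G, hGN, hG⟩ := exists_swapVars_eq g.natDegree (PowerSeries.mk fun n => (f n).1)
    (fun n => by rw [PowerSeries.coeff_mk]; exact hdeg1' n)
  obtain ⟨H, -, hH⟩ := exists_swapVars_eq N (PowerSeries.mk fun n => (f n).2)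
    (fun n => by rw [PowerSeries.coeff_mk]; exact (Nat.le_add_left _ _).trans (hdeg2 n))
  refine ⟨G, H, ?_, ?_, ?_, ?_⟩
  · apply swapVars_injective
    rw [map_mul, hG, hH, hmul]
  -- The corrections in positive powers of `t` have degree below `deg g`, so the top coefficient is
  -- exactly `1`, not only modulo `t`.
  · refine Polynomial.monic_of_natDegree_le_of_coeff_eq_one _ hGN ?_
    ext n
    rw [← swapVars_coeff, hG, PowerSeries.coeff_mk]
    cases n with
    | zero => rw [hf0]; simpa using hg.coeff_natDegree
    | succ n =>
      rw [Polynomial.coeff_eq_zero_of_degree_lt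
        ((hdeg1 n).trans_le Polynomial.degree_le_natDegree), PowerSeries.coeff_one,
        if_neg n.succ_ne_zero]
  · rw [← constantCoeff_swapVars, hG, ← PowerSeries.coeff_zero_eq_constantCoeff_apply,
      PowerSeries.coeff_mk, hf0]
  · rw [← constantCoeff_swapVars, hH, ← PowerSeries.coeff_zero_eq_constantCoeff_apply,
      PowerSeries.coeff_mk, hf0]

theorem reduction_C (a : F⟦X⟧) :
    reduction F (Polynomial.C a) = Polynomial.C (PowerSeries.constantCoeff a) := by
  simp [reduction]

/-- Hensel's lemma, for factors normalized to have constant term `1` in `u`. -/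
theorem exists_hensel_lift_of_coeff_zero (P : F⟦X⟧[X]) {g h : F[X]} (hgh : IsCoprime g h)
    (hP : reduction F P = g * h) (hP0 : P.coeff 0 = 1) (hg0 : g.coeff 0 = 1) :
    ∃ G H : F⟦X⟧[X], P = G * H ∧ G.natDegree ≤ g.natDegree ∧ G.coeff 0 = 1 ∧ H.coeff 0 = 1 ∧
      reduction F G = g ∧ reduction F H = h := by
  have hg : g ≠ 0 := by rintro rfl; simp at hg0
  set a := g.leadingCoeff with ha
  have ha0 : a ≠ 0 := Polynomial.leadingCoeff_ne_zero.2 hg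
  have hu : IsUnit (Polynomial.C a⁻¹) := Polynomial.isUnit_C.2 (inv_ne_zero ha0).isUnit
  have hu' : IsUnit (Polynomial.C a) := Polynomial.isUnit_C.2 ha0.isUnit
  have haa : (Polynomial.C a⁻¹ * Polynomial.C a : F[X]) = 1 := by
    rw [← Polynomial.C_mul, inv_mul_cancel₀ ha0, Polynomial.C_1]
  obtain ⟨G, H, hGH, hGm, hG, hH⟩ := exists_hensel_lift P (g := Polynomial.C a⁻¹ * g)
    (h := Polynomial.C a * h) (by rw [mul_comm]; exact Polynomial.monic_mul_leadingCoeff_inv hg)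
    ((isCoprime_mul_unit_left_left hu _ _).2 ((isCoprime_mul_unit_left_right hu' _ _).2 hgh))
    (by rw [hP]; linear_combination (-(g * h)) * haa)
  have hb : G.coeff 0 * H.coeff 0 = 1 := by rw [← Polynomial.mul_coeff_zero, ← hGH, hP0]
  have hred : PowerSeries.constantCoeff (G.coeff 0) = a⁻¹ := by
    rw [← reduction_coeff, hG, Polynomial.coeff_C_mul, hg0, mul_one]
  have hred' : PowerSeries.constantCoeff (H.coeff 0) = a := by
    have := congrArg PowerSeries.constantCoeff hb
    rw [map_mul, hred, map_one] at this
    field_simp at this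
    exact this
  -- The constant terms in `u` are mutually inverse, so exchanging them as scalars preserves the
  -- product and normalizes both factors.
  refine ⟨Polynomial.C (H.coeff 0) * G, Polynomial.C (G.coeff 0) * H, ?_, ?_, ?_, ?_, ?_, ?_⟩
  · have hb' : (Polynomial.C (G.coeff 0) * Polynomial.C (H.coeff 0) : F⟦X⟧[X]) = 1 := by
      rw [← Polynomial.C_mul, hb, Polynomial.C_1]
    rw [hGH]
    linear_combination (-(G * H)) * hb'
  · refine (Polynomial.natDegree_C_mul_le _ _).trans ?_
    have h1 : (reduction F G).natDegree = G.natDegree := hGm.natDegree_map _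
    rw [← h1, hG]
    exact Polynomial.natDegree_C_mul_le _ _
  · rw [Polynomial.coeff_C_mul, mul_comm, hb]
  · rw [Polynomial.coeff_C_mul, hb]
  · rw [map_mul, reduction_C, hred', hG]
    linear_combination g * haa
  · rw [map_mul, reduction_C, hred, hH]
    linear_combination h * haa

/-- Factors are split off one at a time. The hypothesis that the degree does not drop modulo `t`
passes to the cofactor, and forces the last cofactor, which reduces to `1`, to be `1` itself. -/
theorem exists_hensel_lift_prod {ι : Type*} (s : Finset ι) (g : ι → F[X])
    (hg : (s : Set ι).Pairwise (Function.onFun IsCoprime g)) (hg0 : ∀ i ∈ s, (g i).coeff 0 = 1)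
    (P : F⟦X⟧[X]) (hP : reduction F P = ∏ i ∈ s, g i)
    (hPdeg : P.natDegree ≤ (reduction F P).natDegree) (hP0 : P.coeff 0 = 1) :
    ∃ G : ι → F⟦X⟧[X], P = ∏ i ∈ s, G i ∧ ∀ i ∈ s, (G i).natDegree ≤ (g i).natDegree ∧
      (G i).coeff 0 = 1 ∧ reduction F (G i) = g i := by
  classical
  induction s using Finset.induction_on generalizing P with
  | empty =>
    refine ⟨fun _ => 1, ?_, by simp⟩
    rw [hP] at hPdeg
    simp only [Finset.prod_empty, Polynomial.natDegree_one, Nat.le_zero] at hPdeg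
    rw [Polynomial.eq_C_of_natDegree_eq_zero hPdeg, hP0]
    simp
  | insert i s hi ih =>
    rw [Finset.prod_insert hi] at hP
    have hne : ∀ j ∈ insert i s, g j ≠ 0 := by
      intro j hj h
      have := hg0 j hj
      simp [h] at this
    obtain ⟨G, H, hGH, hGdeg, hG0, hH0, hG, hH⟩ := exists_hensel_lift_of_coeff_zero P
      (IsCoprime.prod_right fun j hj => hg (by simp) (by simp [hj])
        (by rintro rfl; exact hi hj)) hP hP0 (hg0 i (by simp))
    have hGne : G ≠ 0 := by rintro rfl; simp at hG0
    have hHne : H ≠ 0 := by rintro rfl; simp at hH0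
    have hHdeg : H.natDegree ≤ (reduction F H).natDegree := by
      have hpne : ∏ j ∈ s, g j ≠ 0 :=
        Finset.prod_ne_zero_iff.2 fun j hj => hne j (Finset.mem_insert_of_mem hj)
      have h2 : (reduction F G).natDegree ≤ G.natDegree := Polynomial.natDegree_map_le
      rw [hP, Polynomial.natDegree_mul (hne i (by simp)) hpne, hGH,
        Polynomial.natDegree_mul hGne hHne] at hPdeg
      rw [hG] at h2
      rw [hH]
      omega
    obtain ⟨G', hG', hG's⟩ := ih (hg.mono (by simp)) (fun j hj => hg0 j (by simp [hj])) H hH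
      hHdeg hH0
    refine ⟨Function.update G' i G, ?_, ?_⟩
    · rw [Finset.prod_insert hi, Function.update_self, hGH, hG']
      congr 1
      refine Finset.prod_congr rfl fun j hj => ?_
      rw [Function.update_of_ne (ne_of_mem_of_not_mem hj hi)]
    · intro j hj
      rcases Finset.mem_insert.1 hj with rfl | hj
      · rw [Function.update_self]
        exact ⟨hGdeg, hG0, hG⟩
      · rw [Function.update_of_ne (ne_of_mem_of_not_mem hj hi)]
        exact hG's j hj

end Hensel

/-! ### Reduction modulo `t` and polynomials over `F` -/

section Reduction

variable {F : Type*} [Field F]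

@[simp]
theorem reduction_tVar : reduction F (tVar F) = 0 := by simp [tVar, reduction_C]

@[simp]
theorem reduction_uVar : reduction F (uVar F) = Polynomial.X := by simp [uVar, reduction]

@[simp]
theorem reduction_constant (a : F) : reduction F (constant a) = Polynomial.C a := by
  simp [constant, reduction_C]

theorem tVar_ne_zero : tVar F ≠ 0 := by
  simp [tVar, PowerSeries.X_ne_zero]

theorem uVar_ne_zero : uVar F ≠ 0 := Polynomial.X_ne_zero

theorem tVar_dvd_iff (P : F⟦X⟧[X]) : tVar F ∣ P ↔ reduction F P = 0 := by
  rw [tVar, Polynomial.C_dvd_iff_dvd_coeff, Polynomial.ext_iff]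
  simp [reduction_coeff, PowerSeries.X_dvd_iff]

theorem prime_tVar : Prime (tVar F) :=
  Polynomial.prime_C_iff.2 PowerSeries.X_prime

theorem degree_tVar_pow_mul (n : ℕ) (P : F⟦X⟧[X]) : (tVar F ^ n * P).degree = P.degree := by
  rw [tVar, ← Polynomial.C_pow,
    Polynomial.degree_C_mul (pow_ne_zero _ PowerSeries.X_ne_zero)]

theorem degree_tVar_mul (P : F⟦X⟧[X]) : (tVar F * P).degree = P.degree := by
  simpa using degree_tVar_pow_mul 1 P

theorem exists_eq_tVar_pow_mul {P : F⟦X⟧[X]} (hP : P ≠ 0) :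
    ∃ (n : ℕ) (Q : F⟦X⟧[X]), P = tVar F ^ n * Q ∧ reduction F Q ≠ 0 := by
  obtain ⟨Q, h1, h2⟩ :=
    (FiniteMultiplicity.of_prime_left prime_tVar hP).exists_eq_pow_mul_and_not_dvd
  exact ⟨_, Q, h1, fun h => h2 ((tVar_dvd_iff Q).2 h)⟩

/-- This produces `R₁` and the `Qᵢ`: a lift and its model agree modulo `t` and, being normalized,
also at `u = 0`. -/
theorem exists_eq_tVar_mul_uVar_mul {P : F⟦X⟧[X]} (h : reduction F P = 0) (h0 : P.coeff 0 = 0) :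
    ∃ Q, P = tVar F * uVar F * Q := by
  obtain ⟨Q, rfl⟩ := Polynomial.X_dvd_iff.2 h0
  rw [map_mul, show reduction F Polynomial.X = Polynomial.X from reduction_uVar, mul_eq_zero,
    or_iff_right Polynomial.X_ne_zero, ← tVar_dvd_iff] at h
  obtain ⟨R, rfl⟩ := h
  exact ⟨R, by rw [uVar]; ring⟩

theorem reduction_extendScalars {K : Type*} (L : Type*) [Field K] [Field L] [Algebra K L]
    (P : K⟦X⟧[X]) :
    reduction L (extendScalars L P) = (reduction K P).map (algebraMap K L) := by
  ext j
  simp only [reduction_coeff, extendScalars, Polynomial.coe_mapRingHom, Polynomial.coeff_map,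
    ← PowerSeries.coeff_zero_eq_constantCoeff_apply, PowerSeries.coeff_map]

theorem extendScalars_injective {K : Type*} (L : Type*) [Field K] [Field L] [Algebra K L] :
    Function.Injective (extendScalars (K := K) L) := by
  refine Polynomial.map_injective _ fun a b hab => ?_
  ext n
  have := congrArg (PowerSeries.coeff n) hab
  simpa using this

theorem isCoprime_X_pow {w : F[X]} (hw : w.coeff 0 ≠ 0) (d : ℕ) :
    IsCoprime (Polynomial.X ^ d) w :=
  (Polynomial.irreducible_X.coprime_iff_not_dvd.2
    fun h => hw (Polynomial.X_dvd_iff.1 h)).pow_left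

theorem isCoprime_one_sub_inv_mul_X {a b : F} (ha : a ≠ 0) (hb : b ≠ 0) (hab : a ≠ b) :
    IsCoprime (1 - Polynomial.C a⁻¹ * Polynomial.X : F[X])
      (1 - Polynomial.C b⁻¹ * Polynomial.X) := by
  have h : a - b ≠ 0 := sub_ne_zero.2 hab
  -- The two scalars solve `x + y = 1` and `x/a + y/b = 0`.
  refine ⟨Polynomial.C (a / (a - b)), Polynomial.C (-b / (a - b)), ?_⟩
  have h1 : a / (a - b) + -b / (a - b) = 1 := by field_simp; ring
  have h2 : a / (a - b) * a⁻¹ + -b / (a - b) * b⁻¹ = 0 := by field_simp; ring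
  have h1' := congrArg Polynomial.C h1
  have h2' := congrArg Polynomial.C h2
  simp only [Polynomial.C_add, Polynomial.C_mul, Polynomial.C_1, Polynomial.C_0] at h1' h2'
  linear_combination h1' - Polynomial.X * h2'

theorem one_sub_inv_mul_X_eq {a : F} (ha : a ≠ 0) :
    (1 - Polynomial.C a⁻¹ * Polynomial.X : F[X]) =
      Polynomial.C (-a⁻¹) * (Polynomial.X - Polynomial.C a) := by
  have : (Polynomial.C a⁻¹ * Polynomial.C a : F[X]) = 1 := by
    rw [← Polynomial.C_mul, inv_mul_cancel₀ ha, Polynomial.C_1]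
  rw [Polynomial.C_neg]
  linear_combination (-1 : F[X]) * this

theorem natDegree_one_sub_inv_mul_X_pow {a : F} (ha : a ≠ 0) (n : ℕ) :
    ((1 - Polynomial.C a⁻¹ * Polynomial.X : F[X]) ^ n).natDegree = n := by
  rw [Polynomial.natDegree_pow, one_sub_inv_mul_X_eq ha,
    Polynomial.natDegree_C_mul (neg_ne_zero.2 (inv_ne_zero ha)), Polynomial.natDegree_X_sub_C,
    mul_one]

theorem exists_eq_prod_one_sub_inv_mul_X [IsAlgClosed F] {w : F[X]} (hw : w.coeff 0 = 1) :
    ∃ (k : ℕ) (α : Fin k → F) (e : Fin k → ℕ), Function.Injective α ∧ (∀ i, α i ≠ 0) ∧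
      (∀ i, 0 < e i) ∧ w = ∏ i, (1 - Polynomial.C (α i)⁻¹ * Polynomial.X) ^ e i := by
  classical
  have hw0 : w ≠ 0 := by rintro rfl; simp at hw
  set s := w.roots.toFinset with hs
  let α : Fin s.card → F := fun i => (s.equivFin.symm i : F)
  have hroot : ∀ i, α i ∈ w.roots := fun i => Multiset.mem_toFinset.1 (s.equivFin.symm i).2
  have hα : ∀ i, α i ≠ 0 := by
    intro i h
    have := (Polynomial.mem_roots hw0).1 (hroot i)
    rw [h, Polynomial.IsRoot, ← Polynomial.coeff_zero_eq_eval_zero, hw] at this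
    exact one_ne_zero this
  let e : Fin s.card → ℕ := fun i => w.roots.count (α i)
  refine ⟨s.card, α, e, fun i j hij => s.equivFin.symm.injective (Subtype.ext hij), hα,
    fun i => Multiset.count_pos.2 (hroot i), ?_⟩
  have hprod : w = Polynomial.C w.leadingCoeff *
      ∏ i, (Polynomial.X - Polynomial.C (α i)) ^ e i := by
    have h1 := (IsAlgClosed.splits w).eq_prod_roots
    rw [Finset.prod_multiset_map_count, ← Finset.prod_coe_sort,
      ← Equiv.prod_comp s.equivFin.symm] at h1
    exact h1
  set g := ∏ i, (1 - Polynomial.C (α i)⁻¹ * Polynomial.X) ^ e i with hg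
  have hg0 : g.coeff 0 = 1 := by
    simp [hg, Polynomial.coeff_zero_eq_eval_zero, Polynomial.eval_prod]
  have hb : ∃ b : F, b ≠ 0 ∧
      g = Polynomial.C b * ∏ i, (Polynomial.X - Polynomial.C (α i)) ^ e i := by
    refine ⟨∏ i, (-(α i)⁻¹) ^ e i, ?_, ?_⟩
    · exact Finset.prod_ne_zero_iff.2 fun i _ => pow_ne_zero _ (neg_ne_zero.2 (inv_ne_zero (hα i)))
    · rw [map_prod, ← Finset.prod_mul_distrib]
      exact Finset.prod_congr rfl fun i _ => by
        rw [one_sub_inv_mul_X_eq (hα i), mul_pow, Polynomial.C_pow]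
  obtain ⟨b, hb0, hb⟩ := hb
  have hwg : w = Polynomial.C (w.leadingCoeff / b) * g := by
    conv_lhs => rw [hprod]
    rw [hb, ← mul_assoc, ← Polynomial.C_mul, div_mul_cancel₀ _ hb0]
  -- Both polynomials have constant term `1`, so the proportionality scalar is `1`.
  have h3 := congrArg (fun q => Polynomial.coeff q 0) hwg
  simp only [hw, Polynomial.coeff_C_mul, hg0, mul_one] at h3
  rw [← h3, Polynomial.C_1, one_mul] at hwg
  exact hwg

end Reduction

/-! ### Existence of the factorization -/

theorem exists_isFactorizationOf (K : Type*) [Field K] (L : Type*) [Field L] [Algebra K L]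
    [IsAlgClosed L] (Δ : K⟦X⟧[X]) (hΔ : Δ ≠ 0) :
    ∃ D : FactorizationData K L, D.IsFactorizationOf Δ := by
  obtain ⟨p, P, rfl, hP⟩ := exists_eq_tVar_pow_mul hΔ
  obtain ⟨δ, hδ, hδ0⟩ : ∃ δ, reduction K P =
      Polynomial.X ^ (reduction K P).rootMultiplicity 0 * δ ∧ δ.coeff 0 ≠ 0 := by
    obtain ⟨δ, h1, h2⟩ := Polynomial.exists_eq_pow_rootMultiplicity_mul_and_not_dvd _ hP 0
    rw [Polynomial.C_0, sub_zero, Polynomial.X_dvd_iff] at h2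
    rw [Polynomial.C_0, sub_zero] at h1
    exact ⟨δ, h1, h2⟩
  set d := (reduction K P).rootMultiplicity 0
  obtain ⟨Z, H, hZH, hZm, hZ, hH⟩ := exists_hensel_lift P (Polynomial.monic_X_pow d)
    (isCoprime_X_pow hδ0 d) hδ
  have hZd : Z.degree = d := by
    rw [← Polynomial.degree_X_pow (R := K) d, ← hZ]
    exact (hZm.degree_map _).symm
  obtain ⟨R₂, hR₂⟩ : tVar K ∣ Z - uVar K ^ d := by rw [tVar_dvd_iff]; simp [hZ]
  have hR₂d : R₂.degree < d := by
    rw [← degree_tVar_mul, ← hR₂, ← hZd]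
    -- `Z` and `u^d` are both monic of degree `d`, so their leading terms cancel.
    refine Polynomial.degree_sub_lt_left ?_ hZm.ne_zero ?_
    · rw [hZd, uVar, Polynomial.degree_X_pow]
    · rw [hZm.leadingCoeff, uVar, Polynomial.leadingCoeff_X_pow]
  set c := δ.coeff 0 with hc
  have hvc : PowerSeries.constantCoeff (H.coeff 0) = c := by rw [← reduction_coeff, hH]
  obtain ⟨v, hv⟩ : IsUnit (H.coeff 0) := by
    rw [PowerSeries.isUnit_iff_constantCoeff, hvc]
    exact hδ0.isUnit
  obtain ⟨S, hS⟩ : PowerSeries.X ∣ PowerSeries.C c⁻¹ * H.coeff 0 - 1 := by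
    rw [PowerSeries.X_dvd_iff]
    simp [hvc, hδ0]
  have hvS : H.coeff 0 = PowerSeries.C c * (1 + PowerSeries.X * S) := by
    have : (PowerSeries.C c * PowerSeries.C c⁻¹ : K⟦X⟧) = 1 := by
      rw [← map_mul, mul_inv_cancel₀ hδ0, map_one]
    linear_combination (-(H.coeff 0)) * this + PowerSeries.C c * hS
  set N := Polynomial.C (↑v⁻¹ : K⟦X⟧) * H with hN
  have hHN : H = Polynomial.C (H.coeff 0) * N := by
    rw [hN, ← mul_assoc, ← Polynomial.C_mul, ← hv, Units.mul_inv, Polynomial.C_1, one_mul]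
  have hN0 : N.coeff 0 = 1 := by rw [hN, Polynomial.coeff_C_mul, ← hv, Units.inv_mul]
  -- Lifting the trivial factorization `N̄ · 1` makes `G` carry the whole reduction without excess
  -- degree, while `I`, which reduces to `1`, becomes `1 + tuR₁`.
  obtain ⟨G, I, hGI, hGd, hG0, hI0, hG, hI⟩ := exists_hensel_lift_of_coeff_zero N
    (g := reduction K N) isCoprime_one_right (mul_one _).symm hN0
    (by rw [reduction_coeff, hN0, map_one])
  obtain ⟨R₁, hR₁⟩ := exists_eq_tVar_mul_uVar_mul (P := I - 1) (by simp [hI]) (by simp [hI0])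
  have hGL0 : (extendScalars L G).coeff 0 = 1 := by simp [extendScalars, hG0]
  obtain ⟨k, α, e, hinj, hα, he, hw⟩ := exists_eq_prod_one_sub_inv_mul_X
    (w := reduction L (extendScalars L G)) (by rw [reduction_coeff, hGL0, map_one])
  obtain ⟨f, hf, hfi⟩ := exists_hensel_lift_prod Finset.univ _
    (fun i _ j _ hij => (isCoprime_one_sub_inv_mul_X (hα i) (hα j)
      (hinj.ne hij)).pow (m := e i) (n := e j))
    (fun i _ => by simp [Polynomial.coeff_zero_eq_eval_zero]) (extendScalars L G) hw
    (by
      rw [reduction_extendScalars, Polynomial.natDegree_map, hG]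
      exact Polynomial.natDegree_map_le.trans hGd) hGL0
  have hQ : ∀ i, ∃ Q, f i - (1 - constant (α i)⁻¹ * uVar L) ^ e i = tVar L * uVar L * Q :=
    fun i => exists_eq_tVar_mul_uVar_mul (by simp [(hfi i (Finset.mem_univ i)).2.2])
      (by
        rw [Polynomial.coeff_sub, (hfi i (Finset.mem_univ i)).2.1,
          Polynomial.coeff_zero_eq_eval_zero]
        simp [uVar])
  choose Q hQ using hQ
  refine ⟨⟨c, p, S, R₁, d, R₂, k, α, e, Q⟩, ⟨hR₂d, hα, hinj, he, ?_, ?_⟩⟩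
  · intro i
    change (Q i).degree < e i
    have h1 : (f i).degree ≤ e i := by
      rw [← Polynomial.natDegree_le_iff_degree_le]
      have := (hfi i (Finset.mem_univ i)).1
      rwa [natDegree_one_sub_inv_mul_X_pow (hα i)] at this
    have h2 : ((1 - constant (α i)⁻¹ * uVar L) ^ e i).degree ≤ e i := by
      rw [← Polynomial.natDegree_le_iff_degree_le]
      refine (Polynomial.natDegree_pow_le_of_le (m := 1) (e i) ?_).trans_eq (mul_one _)
      rw [constant, uVar]
      compute_degree
    have h3 : (uVar L * Q i).degree ≤ e i := by
      have := (Polynomial.degree_sub_le _ _).trans (max_le h1 h2)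
      rwa [hQ, mul_assoc, degree_tVar_mul] at this
    by_cases h0 : Q i = 0
    · rw [h0, Polynomial.degree_zero]; exact WithBot.bot_lt_coe _
    · rw [← Polynomial.natDegree_lt_iff_degree_lt h0]
      rw [← Polynomial.natDegree_le_iff_degree_le, uVar,
        Polynomial.natDegree_X_mul h0] at h3
      omega
  · change extendScalars L (tVar K ^ p * P) = extendScalars L (constant c * tVar K ^ p *
      (1 + tVar K * Polynomial.C S)) * extendScalars L (1 + tVar K * uVar K * R₁) *
      extendScalars L (uVar K ^ d + tVar K * R₂) *
      ∏ i, ((1 - constant (α i)⁻¹ * uVar L) ^ e i + tVar L * uVar L * Q i)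
    have h1 : ∏ i, ((1 - constant (α i)⁻¹ * uVar L) ^ e i + tVar L * uVar L * Q i) =
        extendScalars L G := by
      rw [hf]
      exact Finset.prod_congr rfl fun i _ => by rw [← hQ]; ring
    rw [h1, ← map_mul, ← map_mul, ← map_mul, ← hR₁, ← hR₂, hZH, hHN, hGI, hvS]
    congr 1
    simp only [constant, tVar, Polynomial.C_mul, Polynomial.C_add, Polynomial.C_1]
    ring

/-! ### Values of Puiseux series at `t = 0` -/

namespace PuiseuxSeries

variable {L : Type*} [Field L]

theorem isFiniteAtZero_iff (U : PuiseuxSeries L) :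
    IsFiniteAtZero U ↔ 0 ≤ (U : L⟦ℚ⟧).orderTop := by
  rw [HahnSeries.le_orderTop_iff_forall]
  simp [IsFiniteAtZero]

theorem not_isFiniteAtZero_iff (U : PuiseuxSeries L) :
    ¬ IsFiniteAtZero U ↔ IsInfiniteAtZero U := by
  simp [IsFiniteAtZero, IsInfiniteAtZero]

/-- A series of nonnegative order differs from its constant coefficient by a series of positive
order, and such errors stay of positive order when multiplied by series of nonnegative order. -/
theorem coeff_zero_mul {x y : L⟦ℚ⟧} (hx : 0 ≤ x.orderTop) (hy : 0 ≤ y.orderTop) :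
    (x * y).coeff 0 = x.coeff 0 * y.coeff 0 := by
  have key : ∀ z : L⟦ℚ⟧, 0 ≤ z.orderTop → 0 < (z - HahnSeries.C (z.coeff 0)).orderTop := by
    intro z hz
    refine lt_of_le_of_ne ?_ ?_
    · rw [HahnSeries.le_orderTop_iff_forall] at hz ⊢
      intro q hq
      rw [HahnSeries.coeff_sub, hz q hq, HahnSeries.C_apply, HahnSeries.coeff_single_of_ne, sub_zero]
      rintro rfl
      simp at hq
    · refine (HahnSeries.orderTop_ne_of_coeff_eq_zero (i := 0) ?_).symm
      simp
  have h1 : x * y = HahnSeries.C (x.coeff 0) * HahnSeries.C (y.coeff 0) +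
      ((x - HahnSeries.C (x.coeff 0)) * y +
        (y - HahnSeries.C (y.coeff 0)) * HahnSeries.C (x.coeff 0)) := by ring
  have h2 : ((x - HahnSeries.C (x.coeff 0)) * y).coeff 0 = 0 := by
    apply HahnSeries.coeff_eq_zero_of_lt_orderTop
    rw [HahnSeries.orderTop_mul]
    exact add_pos_of_pos_of_nonneg (key x hx) hy
  have h3 : ((y - HahnSeries.C (y.coeff 0)) * HahnSeries.C (x.coeff 0)).coeff 0 = 0 := by
    apply HahnSeries.coeff_eq_zero_of_lt_orderTop
    rw [HahnSeries.orderTop_mul]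
    exact add_pos_of_pos_of_nonneg (key y hy) HahnSeries.orderTop_single_le
  rw [h1, HahnSeries.coeff_add, HahnSeries.coeff_add, h2, h3, ← map_mul]
  simp

/-- The ring of Puiseux series that are finite at `t = 0`. -/
noncomputable def finiteSubring (L : Type*) [Field L] : Subring (PuiseuxSeries L) where
  carrier := {U | IsFiniteAtZero U}
  mul_mem' := by
    intro x y hx hy
    rw [Set.mem_ofPred_eq, isFiniteAtZero_iff] at *
    rw [Subfield.coe_mul, HahnSeries.orderTop_mul]
    exact add_nonneg hx hy
  one_mem' := by
    rw [Set.mem_ofPred_eq, isFiniteAtZero_iff, Subfield.coe_one, HahnSeries.orderTop_one]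
  add_mem' := by
    intro x y hx hy q hq
    rw [Subfield.coe_add, HahnSeries.coeff_add, hx q hq, hy q hq, add_zero]
  zero_mem' := fun q _ => by simp
  neg_mem' := by
    intro x hx q hq
    rw [Subfield.coe_neg, HahnSeries.coeff_neg, hx q hq, neg_zero]

/-- The value at `t = 0`. -/
noncomputable def valueAtZero (L : Type*) [Field L] : finiteSubring L →+* L where
  toFun U := ((U : PuiseuxSeries L) : L⟦ℚ⟧).coeff 0
  map_one' := by simp
  map_zero' := by simp
  map_add' x y := by simp
  map_mul' x y := by
    rw [Subring.coe_mul, Subfield.coe_mul]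
    exact coeff_zero_mul ((isFiniteAtZero_iff _).1 x.2) ((isFiniteAtZero_iff _).1 y.2)

theorem isFiniteAtZero_powerSeries (f : L⟦X⟧) : IsFiniteAtZero (powerSeriesToPuiseux L f) := by
  intro q hq
  by_contra h
  obtain ⟨n, -, rfl⟩ := HahnSeries.support_embDomain_subset
    (x := HahnSeries.toPowerSeries.symm f) (a := q) h
  exact absurd hq (not_lt.2 (Nat.cast_nonneg (α := ℚ) n))

theorem coeff_zero_powerSeries (f : L⟦X⟧) :
    (powerSeriesToPuiseux L f : L⟦ℚ⟧).coeff 0 = PowerSeries.constantCoeff f := by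
  have h := HahnSeries.ofPowerSeries_apply_coeff (Γ := ℚ) f 0
  rw [Nat.cast_zero] at h
  rw [← PowerSeries.coeff_zero_eq_constantCoeff_apply]
  exact h

theorem powerSeriesToPuiseux_injective : Function.Injective (powerSeriesToPuiseux L) :=
  fun _ _ h => HahnSeries.ofPowerSeries_injective (congrArg Subtype.val h)

/-- The value at `t = 0` is a ring homomorphism on finite series extending the constant coefficient
of `L[[t]]`, so it commutes with polynomial evaluation. -/
theorem eval_finite (P : L⟦X⟧[X]) {U : PuiseuxSeries L} (hU : IsFiniteAtZero U) :
    ((P.eval₂ (powerSeriesToPuiseux L) U : PuiseuxSeries L) : L⟦ℚ⟧).coeff 0 =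
      (reduction L P).eval ((U : L⟦ℚ⟧).coeff 0) := by
  let ι : L⟦X⟧ →+* finiteSubring L :=
    (powerSeriesToPuiseux L).codRestrict (finiteSubring L) isFiniteAtZero_powerSeries
  let V : finiteSubring L := ⟨U, hU⟩
  have h1 : P.eval₂ (powerSeriesToPuiseux L) U = (P.eval₂ ι V : finiteSubring L) :=
    (Polynomial.hom_eval₂ P ι (finiteSubring L).subtype V).symm
  have h2 : valueAtZero L (P.eval₂ ι V) = (reduction L P).eval ((U : L⟦ℚ⟧).coeff 0) := by
    rw [Polynomial.hom_eval₂, reduction, Polynomial.coe_mapRingHom, Polynomial.eval_map]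
    congr 1
    ext f
    exact coeff_zero_powerSeries f
  rw [h1]
  exact h2

theorem eval_reduction_of_mem_puiseuxRoots {P : L⟦X⟧[X]} {U : PuiseuxSeries L}
    (hU : U ∈ puiseuxRoots P) (hf : IsFiniteAtZero U) :
    (reduction L P).eval ((U : L⟦ℚ⟧).coeff 0) = 0 := by
  have h := Polynomial.isRoot_of_mem_roots hU
  rw [Polynomial.IsRoot, Polynomial.eval_map] at h
  rw [← eval_finite P hf, h]
  simp

/-- The inverse of an infinite root has value `0` and is a root of the reversed polynomial. At `t =
0` this would annihilate the constant term of the leading coefficient, which is nonzero because the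
degree does not drop. -/
theorem isFiniteAtZero_of_mem_puiseuxRoots {P : L⟦X⟧[X]} (hP : reduction L P ≠ 0)
    (hdeg : P.natDegree ≤ (reduction L P).natDegree) {U : PuiseuxSeries L}
    (hU : U ∈ puiseuxRoots P) : IsFiniteAtZero U := by
  by_contra hf
  have hlt : (U : L⟦ℚ⟧).orderTop < 0 := by rwa [isFiniteAtZero_iff, not_le] at hf
  have hU0 : U ≠ 0 := by rintro rfl; simp at hlt
  have hinv : 0 < ((U⁻¹ : PuiseuxSeries L) : L⟦ℚ⟧).orderTop := by
    by_contra hle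
    rw [not_lt] at hle
    have h1 : (U : L⟦ℚ⟧) * ((U⁻¹ : PuiseuxSeries L) : L⟦ℚ⟧) = 1 := by
      rw [← Subfield.coe_mul, mul_inv_cancel₀ hU0, Subfield.coe_one]
    have h2 := congrArg HahnSeries.orderTop h1
    rw [HahnSeries.orderTop_mul, HahnSeries.orderTop_one] at h2
    exact absurd h2 (add_neg_of_neg_of_nonpos hlt hle).ne
  have h := Polynomial.isRoot_of_mem_roots hU
  rw [Polynomial.IsRoot, Polynomial.eval_map] at h
  have hrev : P.reverse.eval₂ (powerSeriesToPuiseux L) U⁻¹ = 0 := by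
    let := invertibleOfNonzero hU0
    have h3 := Polynomial.eval₂_reverse_eq_zero_iff (powerSeriesToPuiseux L) U P
    rw [invOf_eq_inv] at h3
    exact h3.2 h
  have h4 := eval_finite P.reverse ((isFiniteAtZero_iff _).2 hinv.le)
  rw [hrev, HahnSeries.coeff_eq_zero_of_lt_orderTop hinv,
    ← Polynomial.coeff_zero_eq_eval_zero, reduction_coeff, Polynomial.coeff_zero_reverse] at h4
  have hle : (reduction L P).natDegree ≤ P.natDegree := Polynomial.natDegree_map_le
  have h5 : PowerSeries.constantCoeff P.leadingCoeff = (reduction L P).leadingCoeff := by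
    rw [Polynomial.leadingCoeff, Polynomial.leadingCoeff, ← le_antisymm hdeg hle, reduction_coeff]
  rw [h5] at h4
  exact hP (Polynomial.leadingCoeff_eq_zero.1 (by simpa using h4.symm))

end PuiseuxSeries

/-! ### Additivity of root multisets -/

section Roots

variable {L : Type*} [Field L]

theorem map_powerSeriesToPuiseux_ne_zero {P : L⟦X⟧[X]} (hP : P ≠ 0) :
    P.map (powerSeriesToPuiseux L) ≠ 0 :=
  (Polynomial.map_ne_zero_iff PuiseuxSeries.powerSeriesToPuiseux_injective).2 hP

theorem puiseuxRootsWith_eq {p : PuiseuxSeries L → Prop} {P : L⟦X⟧[X]}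
    (h : ∀ U ∈ puiseuxRoots P, p U) : puiseuxRootsWith p P = puiseuxRoots P := by
  classical
  exact Multiset.filter_eq_self.2 h

theorem puiseuxRootsWith_eq_zero {p : PuiseuxSeries L → Prop} {P : L⟦X⟧[X]}
    (h : ∀ U ∈ puiseuxRoots P, ¬ p U) : puiseuxRootsWith p P = 0 := by
  classical
  exact Multiset.filter_eq_nil.2 h

theorem puiseuxRoots_mul {P Q : L⟦X⟧[X]} (h : P * Q ≠ 0) :
    puiseuxRoots (P * Q) = puiseuxRoots P + puiseuxRoots Q := by
  rw [puiseuxRoots, Polynomial.map_mul, Polynomial.roots_mul]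
  · rfl
  · rw [← Polynomial.map_mul]
    exact map_powerSeriesToPuiseux_ne_zero h

theorem puiseuxRootsWith_mul (p : PuiseuxSeries L → Prop) {P Q : L⟦X⟧[X]} (h : P * Q ≠ 0) :
    puiseuxRootsWith p (P * Q) = puiseuxRootsWith p P + puiseuxRootsWith p Q := by
  classical
  rw [puiseuxRootsWith, puiseuxRoots_mul h, Multiset.filter_add]
  rfl

theorem puiseuxRoots_C (a : L⟦X⟧) : puiseuxRoots (Polynomial.C a) = 0 := by
  rw [puiseuxRoots, Polynomial.map_C, Polynomial.roots_C]

theorem puiseuxRoots_prod {ι : Type*} (s : Finset ι) (f : ι → L⟦X⟧[X]) (h : ∏ i ∈ s, f i ≠ 0) :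
    puiseuxRoots (∏ i ∈ s, f i) = ∑ i ∈ s, puiseuxRoots (f i) := by
  rw [puiseuxRoots, Polynomial.map_prod, Polynomial.roots_prod]
  · rfl
  · rw [← Polynomial.map_prod]
    exact map_powerSeriesToPuiseux_ne_zero h

theorem puiseuxRootsWith_prod {ι : Type*} (p : PuiseuxSeries L → Prop) (s : Finset ι)
    (f : ι → L⟦X⟧[X]) (h : ∏ i ∈ s, f i ≠ 0) :
    puiseuxRootsWith p (∏ i ∈ s, f i) = ∑ i ∈ s, puiseuxRootsWith p (f i) := by
  classical
  rw [puiseuxRootsWith, puiseuxRoots_prod s f h]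
  exact map_sum (⟨⟨Multiset.filter p, Multiset.filter_zero p⟩, Multiset.filter_add p⟩ :
    Multiset (PuiseuxSeries L) →+ Multiset (PuiseuxSeries L)) _ _

end Roots

/-! ### Localization of the roots of each factor -/

namespace FactorizationData

variable {K L : Type*} [Field K] [Field L]

@[simp]
theorem reduction_finiteFactor (D : FactorizationData K L) (i : Fin D.k) :
    reduction L (D.finiteFactor i) =
      (1 - Polynomial.C (D.α i)⁻¹ * Polynomial.X) ^ D.e i := by
  simp [finiteFactor]

variable [Algebra K L]

/-- The unit `c (1 + t S(t))` of `K[[t]]`, up to the vanishing of `c`. -/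
noncomputable def unitSeries (D : FactorizationData K L) : K⟦X⟧ :=
  PowerSeries.C D.c * (1 + PowerSeries.X * D.S)

theorem extendScalars_unitPart (D : FactorizationData K L) :
    extendScalars L D.unitPart = tVar L ^ D.p *
      Polynomial.C (PowerSeries.map (algebraMap K L) D.unitSeries) := by
  simp only [unitPart, unitSeries, extendScalars, constant, tVar, Polynomial.coe_mapRingHom,
    Polynomial.map_pow, Polynomial.map_C, map_mul, map_add, map_one, PowerSeries.map_X, PowerSeries.map_C]
  ring

@[simp]
theorem reduction_infiniteFactor (D : FactorizationData K L) :
    reduction L (extendScalars L D.infiniteFactor) = 1 := by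
  rw [reduction_extendScalars]
  simp [infiniteFactor]

@[simp]
theorem reduction_zeroFactor (D : FactorizationData K L) :
    reduction L (extendScalars L D.zeroFactor) = Polynomial.X ^ D.d := by
  rw [reduction_extendScalars]
  simp [zeroFactor]

theorem reduction_C_map_unitSeries (D : FactorizationData K L) :
    reduction L (Polynomial.C (PowerSeries.map (algebraMap K L) D.unitSeries)) =
      Polynomial.C (algebraMap K L D.c) := by
  rw [reduction_C, ← PowerSeries.coeff_zero_eq_constantCoeff_apply, PowerSeries.coeff_map,
    PowerSeries.coeff_zero_eq_constantCoeff_apply]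
  simp [unitSeries]

theorem isInfiniteAtZero_of_mem_puiseuxRoots (D : FactorizationData K L) (U : PuiseuxSeries L)
    (hU : U ∈ puiseuxRoots (extendScalars L D.infiniteFactor)) :
    PuiseuxSeries.IsInfiniteAtZero U := by
  rw [← PuiseuxSeries.not_isFiniteAtZero_iff]
  intro hf
  have := PuiseuxSeries.eval_reduction_of_mem_puiseuxRoots hU hf
  simp at this

namespace IsFactorizationOf

variable {D : FactorizationData K L} {Δ : K⟦X⟧[X]}

theorem natDegree_zeroFactor_le (h : D.IsFactorizationOf Δ) :
    (extendScalars L D.zeroFactor).natDegree ≤ D.d := by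
  refine Polynomial.natDegree_map_le.trans ?_
  rw [Polynomial.natDegree_le_iff_degree_le, zeroFactor]
  refine (Polynomial.degree_add_le _ _).trans (max_le ?_ ?_)
  · exact Polynomial.degree_X_pow_le _
  · rw [degree_tVar_mul]
    exact h.degree_R₂.le

theorem natDegree_finiteFactor_le (h : D.IsFactorizationOf Δ) (i : Fin D.k) :
    (D.finiteFactor i).natDegree ≤ D.e i := by
  rw [finiteFactor]
  refine (Polynomial.natDegree_add_le _ _).trans (max_le ?_ ?_)
  · refine (Polynomial.natDegree_pow_le_of_le (m := 1) (D.e i) ?_).trans_eq (mul_one _)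
    rw [constant, uVar]
    compute_degree
  · by_cases h0 : D.Q i = 0
    · simp [h0]
    · have h1 := (Polynomial.natDegree_lt_iff_degree_lt h0).2 (h.degree_Q i)
      rw [Polynomial.natDegree_le_iff_degree_le, mul_assoc, degree_tVar_mul,
        ← Polynomial.natDegree_le_iff_degree_le, uVar, Polynomial.natDegree_X_mul h0]
      omega

theorem isEqualAtZero_zero_of_mem (h : D.IsFactorizationOf Δ) (U : PuiseuxSeries L)
    (hU : U ∈ puiseuxRoots (extendScalars L D.zeroFactor)) :
    PuiseuxSeries.IsEqualAtZero 0 U := by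
  have hf : PuiseuxSeries.IsFiniteAtZero U :=
    PuiseuxSeries.isFiniteAtZero_of_mem_puiseuxRoots (by simp)
      (by simpa using h.natDegree_zeroFactor_le) hU
  have h1 := PuiseuxSeries.eval_reduction_of_mem_puiseuxRoots hU hf
  rw [reduction_zeroFactor, Polynomial.eval_pow, Polynomial.eval_X] at h1
  exact ⟨hf, eq_zero_of_pow_eq_zero h1⟩

theorem isEqualAtZero_α_of_mem (h : D.IsFactorizationOf Δ) (i : Fin D.k) (U : PuiseuxSeries L)
    (hU : U ∈ puiseuxRoots (D.finiteFactor i)) :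
    PuiseuxSeries.IsEqualAtZero (D.α i) U := by
  have hα := h.α_ne_zero i
  have hne : (1 - Polynomial.C (D.α i)⁻¹ * Polynomial.X : L[X]) ≠ 0 := by
    intro h0
    have := congrArg (Polynomial.eval 0) h0
    simp at this
  have hf : PuiseuxSeries.IsFiniteAtZero U :=
    PuiseuxSeries.isFiniteAtZero_of_mem_puiseuxRoots (by simp [hne])
      (by
        rw [reduction_finiteFactor, natDegree_one_sub_inv_mul_X_pow hα]
        exact h.natDegree_finiteFactor_le i) hU
  have h1 := PuiseuxSeries.eval_reduction_of_mem_puiseuxRoots hU hf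
  rw [reduction_finiteFactor, Polynomial.eval_pow] at h1
  have h2 := eq_zero_of_pow_eq_zero h1
  simp only [Polynomial.eval_sub, Polynomial.eval_one, Polynomial.eval_mul, Polynomial.eval_C,
    Polynomial.eval_X] at h2
  refine ⟨hf, ?_⟩
  field_simp at h2
  linear_combination -h2

/-- The remaining factor `c t^p (1 + tS)` is constant in `u` and contributes no root. -/
theorem puiseuxRootsWith_extendScalars (h : D.IsFactorizationOf Δ) (hΔ : Δ ≠ 0)
    (p : PuiseuxSeries L → Prop) :
    puiseuxRootsWith p (extendScalars L Δ) =
      puiseuxRootsWith p (extendScalars L D.infiniteFactor) +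
      puiseuxRootsWith p (extendScalars L D.zeroFactor) +
      ∑ i, puiseuxRootsWith p (D.finiteFactor i) := by
  have hne : extendScalars L Δ ≠ 0 :=
    (map_ne_zero_iff _ (extendScalars_injective L)).2 hΔ
  rw [h.eq] at hne ⊢
  have h1 := left_ne_zero_of_mul hne
  have h2 := left_ne_zero_of_mul h1
  have hu : puiseuxRootsWith p (extendScalars L D.unitPart) = 0 := by
    refine puiseuxRootsWith_eq_zero fun U hU => ?_
    rw [extendScalars_unitPart, tVar, ← Polynomial.C_pow, ← Polynomial.C_mul,
      puiseuxRoots_C] at hU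
    simp at hU
  rw [puiseuxRootsWith_mul p hne, puiseuxRootsWith_mul p h1, puiseuxRootsWith_mul p h2,
    puiseuxRootsWith_prod p _ _ (right_ne_zero_of_mul hne), hu, zero_add]

/-- Each condition at `t = 0` holds for all roots of a given factor or for none of them, so
filtering keeps or discards whole multisets. -/
theorem puiseuxRoots_localization (h : D.IsFactorizationOf Δ) (hΔ : Δ ≠ 0) :
    puiseuxRootsWith PuiseuxSeries.IsInfiniteAtZero (extendScalars L Δ) =
        puiseuxRoots (extendScalars L D.infiniteFactor) ∧
      puiseuxRootsWith (PuiseuxSeries.IsEqualAtZero 0) (extendScalars L Δ) =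
        puiseuxRoots (extendScalars L D.zeroFactor) ∧
      puiseuxRootsWith PuiseuxSeries.IsFiniteNonzeroAtZero (extendScalars L Δ) =
        puiseuxRoots (∏ i, D.finiteFactor i) ∧
      ∀ i, puiseuxRootsWith (PuiseuxSeries.IsEqualAtZero (D.α i)) (extendScalars L Δ) =
        puiseuxRoots (D.finiteFactor i) := by
  have hne : extendScalars L Δ ≠ 0 :=
    (map_ne_zero_iff _ (extendScalars_injective L)).2 hΔ
  rw [h.eq] at hne
  have hI := D.isInfiniteAtZero_of_mem_puiseuxRoots
  have hZ := h.isEqualAtZero_zero_of_mem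
  have hF := h.isEqualAtZero_α_of_mem
  have hnot : ∀ U : PuiseuxSeries L, PuiseuxSeries.IsInfiniteAtZero U →
      ¬ PuiseuxSeries.IsFiniteAtZero U := fun U =>
    (PuiseuxSeries.not_isFiniteAtZero_iff U).2
  refine ⟨?_, ?_, ?_, fun i => ?_⟩
  · rw [h.puiseuxRootsWith_extendScalars hΔ, puiseuxRootsWith_eq hI,
      puiseuxRootsWith_eq_zero fun U hU hp => hnot U hp (hZ U hU).1,
      Finset.sum_eq_zero fun i _ =>
        puiseuxRootsWith_eq_zero fun U hU hp => hnot U hp (hF i U hU).1,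
      add_zero, add_zero]
  · rw [h.puiseuxRootsWith_extendScalars hΔ, puiseuxRootsWith_eq hZ,
      puiseuxRootsWith_eq_zero fun U hU hp => hnot U (hI U hU) hp.1,
      Finset.sum_eq_zero fun i _ => puiseuxRootsWith_eq_zero fun U hU hp =>
        h.α_ne_zero i ((hF i U hU).2.symm.trans hp.2),
      zero_add, add_zero]
  · rw [h.puiseuxRootsWith_extendScalars hΔ,
      puiseuxRootsWith_eq_zero fun U hU hp => hnot U (hI U hU) hp.1,
      puiseuxRootsWith_eq_zero fun U hU hp => hp.2 (hZ U hU).2,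
      zero_add, zero_add, puiseuxRoots_prod _ _ (right_ne_zero_of_mul hne)]
    exact Finset.sum_congr rfl fun i _ => puiseuxRootsWith_eq fun U hU =>
      ⟨(hF i U hU).1, by rw [(hF i U hU).2]; exact h.α_ne_zero i⟩
  · rw [h.puiseuxRootsWith_extendScalars hΔ,
      puiseuxRootsWith_eq_zero fun U hU hp => hnot U (hI U hU) hp.1,
      puiseuxRootsWith_eq_zero fun U hU hp =>
        h.α_ne_zero i (hp.2.symm.trans (hZ U hU).2),
      zero_add, zero_add, Finset.sum_eq_single i, puiseuxRootsWith_eq (hF i)]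
    · exact fun j _ hj => puiseuxRootsWith_eq_zero fun U hU hp =>
        hj (h.α_injective ((hF j U hU).2.symm.trans hp.2))
    · exact fun hi => absurd (Finset.mem_univ i) hi

end IsFactorizationOf

end FactorizationData

/-! ### Uniqueness of the factorization -/

theorem eq_of_pow_mul_eq_pow_mul {R : Type*} [CommRing R] [IsDomain R] {q a b : R} (hq : q ≠ 0)
    (ha : ¬ q ∣ a) (hb : ¬ q ∣ b) {m n : ℕ} (h : q ^ m * a = q ^ n * b) : m = n ∧ a = b := by
  have key : ∀ {a b : R} {m n : ℕ}, ¬ q ∣ a → q ^ m * a = q ^ n * b → n ≤ m := by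
    intro a b m n ha h
    by_contra hlt
    obtain ⟨k, rfl⟩ := Nat.exists_eq_add_of_lt (not_le.1 hlt)
    refine ha ⟨q ^ k * b, mul_left_cancel₀ (pow_ne_zero m hq) ?_⟩
    rw [h]
    ring
  obtain rfl := le_antisymm (key hb h.symm) (key ha h)
  exact ⟨rfl, mul_left_cancel₀ (pow_ne_zero m hq) h⟩

section Uniqueness

variable {F : Type*} [Field F]

theorem eq_of_C_mul_X_pow_mul_eq {c c' : F} {d d' : ℕ} {w w' : F[X]} (hc : c ≠ 0) (hc' : c' ≠ 0)
    (hw : w.coeff 0 = 1) (hw' : w'.coeff 0 = 1)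
    (h : Polynomial.C c * Polynomial.X ^ d * w = Polynomial.C c' * Polynomial.X ^ d' * w') :
    c = c' ∧ d = d' ∧ w = w' := by
  have h1 : Polynomial.X ^ d * (Polynomial.C c * w) =
      Polynomial.X ^ d' * (Polynomial.C c' * w') := by linear_combination h
  obtain ⟨hd, h2⟩ := eq_of_pow_mul_eq_pow_mul Polynomial.X_ne_zero
    (by rw [Polynomial.X_dvd_iff, Polynomial.coeff_C_mul, hw, mul_one]; exact hc)
    (by rw [Polynomial.X_dvd_iff, Polynomial.coeff_C_mul, hw', mul_one]; exact hc') h1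
  have h3 : c = c' := by
    have := congrArg (fun q => Polynomial.coeff q 0) h2
    simpa [Polynomial.coeff_C_mul, hw, hw'] using this
  subst h3
  exact ⟨rfl, hd, mul_left_cancel₀ (Polynomial.C_ne_zero.2 hc) h2⟩

theorem count_roots_prod_one_sub [DecidableEq F] {ι : Type*} [Fintype ι] [DecidableEq ι]
    {α : ι → F} (hα : ∀ i, α i ≠ 0) (e : ι → ℕ) (a : F) :
    (∏ i, (1 - Polynomial.C (α i)⁻¹ * Polynomial.X) ^ e i).roots.count a =
      ∑ i, if a = α i then e i else 0 := by
  have hne : ∏ i, (1 - Polynomial.C (α i)⁻¹ * Polynomial.X) ^ e i ≠ 0 := by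
    intro h0
    have := congrArg (Polynomial.eval 0) h0
    simp [Polynomial.eval_prod] at this
  rw [Polynomial.roots_prod _ _ hne]
  simp only [Polynomial.roots_pow]
  rw [Multiset.count_bind]
  simp only [Multiset.count_nsmul]
  refine Finset.sum_congr rfl fun i _ => ?_
  rw [one_sub_inv_mul_X_eq (hα i),
    Polynomial.roots_C_mul _ (neg_ne_zero.2 (inv_ne_zero (hα i))), Polynomial.roots_X_sub_C,
    Multiset.count_singleton]
  simp

/-- Root multiplicities recover the data: positive exponents make the `α i` exactly the roots, and
injectivity makes `e i` the multiplicity of `α i`. -/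
theorem exists_equiv_of_prod_one_sub_eq {ι ι' : Type*} [Fintype ι] [Fintype ι']
    {α : ι → F} {e : ι → ℕ} {α' : ι' → F} {e' : ι' → ℕ}
    (hα : ∀ i, α i ≠ 0) (hα' : ∀ i, α' i ≠ 0) (hinj : Function.Injective α)
    (hinj' : Function.Injective α') (he : ∀ i, 0 < e i) (he' : ∀ i, 0 < e' i)
    (h : ∏ i, (1 - Polynomial.C (α i)⁻¹ * Polynomial.X) ^ e i =
      ∏ i, (1 - Polynomial.C (α' i)⁻¹ * Polynomial.X) ^ e' i) :
    ∃ σ : ι ≃ ι', ∀ i, α i = α' (σ i) ∧ e i = e' (σ i) := by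
  classical
  have hcount : ∀ a, (∑ i, if a = α i then e i else 0) = ∑ i, if a = α' i then e' i else 0 :=
    fun a => by rw [← count_roots_prod_one_sub hα, ← count_roots_prod_one_sub hα', h]
  have hl : ∀ i, (∑ j, if α i = α j then e j else 0) = e i := fun i => by
    simp [hinj.eq_iff]
  have hr : ∀ i, (∑ j, if α' i = α' j then e' j else 0) = e' i := fun i => by
    simp [hinj'.eq_iff]
  have hex : ∀ i, ∃ j, α i = α' j := by
    intro i
    by_contra! hne
    have := hcount (α i)
    simp only [hl, hne, if_false, Finset.sum_const_zero] at this
    exact (he i).ne' this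
  have hex' : ∀ j, ∃ i, α i = α' j := by
    intro j
    by_contra! hne
    have := hcount (α' j)
    simp only [hr, (hne _).symm, if_false, Finset.sum_const_zero] at this
    exact (he' j).ne this
  choose σ hσ using hex
  refine ⟨Equiv.ofBijective σ ⟨fun i j hij => hinj (by rw [hσ, hσ, hij]), fun j => ?_⟩,
    fun i => ⟨hσ i, ?_⟩⟩
  · obtain ⟨i, hi⟩ := hex' j
    exact ⟨i, hinj' (by rw [← hσ, hi])⟩
  · change e i = e' (σ i)
    rw [← hl i, hcount (α i), hσ i, hr]

/-- Uniqueness in Hensel's lemma: two lifts `f`, `f'` of the same polynomial, coprime to the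
complementary factor modulo `t`, agree. -/
theorem eq_zero_of_mul_eq_mul {f f' h h' m z : F⟦X⟧[X]} (hmul : f * h = f' * h')
    (hsub : f - f' = tVar F * m * z) (hz : z.degree < (reduction F f).degree)
    (hm : IsCoprime (reduction F f) (reduction F m))
    (hh : IsCoprime (reduction F f) (reduction F h)) : z = 0 := by
  by_contra hz0
  obtain ⟨n, x, rfl, hx⟩ := exists_eq_tVar_pow_mul hz0
  rw [degree_tVar_pow_mul] at hz
  have hred : reduction F f = reduction F f' := by
    rw [← sub_eq_zero, ← map_sub, hsub]
    simp
  have hf' : ¬ tVar F ∣ f' := by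
    rw [tVar_dvd_iff, ← hred]
    intro h0
    simp [h0] at hz
  -- As `f'` is not divisible by the prime `t`, the whole power `t^(n+1)` must divide `h' - h`.
  have h1 : f' * (h' - h) = tVar F ^ (n + 1) * (m * x * h) := by
    linear_combination h * hsub - hmul
  obtain ⟨y, hy⟩ := prime_tVar.pow_dvd_of_dvd_mul_left (n + 1) hf' ⟨_, h1⟩
  have h2 : f' * y = m * x * h := by
    refine mul_left_cancel₀ (pow_ne_zero (n + 1) tVar_ne_zero) ?_
    rw [← h1, hy]
    ring
  have h3 : reduction F f ∣ reduction F m * (reduction F x * reduction F h) := by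
    refine ⟨reduction F y, ?_⟩
    rw [hred, ← map_mul, ← map_mul, ← map_mul, h2, mul_assoc]
  -- Coprimality leaves the reduced `f` dividing the nonzero reduced `x`, which has smaller degree.
  have h4 := hh.dvd_of_dvd_mul_right (hm.dvd_of_dvd_mul_left h3)
  exact absurd (Polynomial.degree_le_of_dvd h4 hx)
    (not_le.2 ((Polynomial.degree_map_le).trans_lt hz))

end Uniqueness

namespace FactorizationData.IsFactorizationOf

variable {K L : Type*} [Field K] [Field L] [Algebra K L] {D D' : FactorizationData K L}
  {Δ : K⟦X⟧[X]}

theorem c_ne_zero (h : D.IsFactorizationOf Δ) (hΔ : Δ ≠ 0) : D.c ≠ 0 := by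
  intro hc
  have heq := h.eq
  rw [extendScalars_unitPart, unitSeries, hc] at heq
  simp only [map_zero, zero_mul, mul_zero] at heq
  exact hΔ ((map_eq_zero_iff _ (extendScalars_injective L)).1 heq)

theorem eq_tVar_pow_mul (h : D.IsFactorizationOf Δ) : extendScalars L Δ = tVar L ^ D.p *
    (Polynomial.C (PowerSeries.map (algebraMap K L) D.unitSeries) *
      extendScalars L D.infiniteFactor * extendScalars L D.zeroFactor *
        ∏ i, D.finiteFactor i) := by
  rw [h.eq, extendScalars_unitPart]
  ring

theorem coeff_zero_prod_one_sub {ι : Type*} (s : Finset ι) (α : ι → L) (e : ι → ℕ) :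
    (∏ i ∈ s, (1 - Polynomial.C (α i)⁻¹ * Polynomial.X) ^ e i).coeff 0 = 1 := by
  simp [Polynomial.coeff_zero_eq_eval_zero, Polynomial.eval_prod]

/-- Here `m = 1`, and the complementary factor is coprime to `u^d` modulo `t` because its value at
`u = 0` is `c ≠ 0`. -/
theorem R₂_eq (h : D.IsFactorizationOf Δ) (h' : D'.IsFactorizationOf Δ) (hc : D.c ≠ 0)
    (hd : D.d = D'.d)
    (heq : Polynomial.C (PowerSeries.map (algebraMap K L) D.unitSeries) *
      extendScalars L D.infiniteFactor * extendScalars L D.zeroFactor * ∏ i, D.finiteFactor i =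
      Polynomial.C (PowerSeries.map (algebraMap K L) D'.unitSeries) *
      extendScalars L D'.infiniteFactor * extendScalars L D'.zeroFactor *
        ∏ i, D'.finiteFactor i) : D.R₂ = D'.R₂ := by
  have hz : extendScalars L (D.R₂ - D'.R₂) = 0 := by
    refine eq_zero_of_mul_eq_mul (f := extendScalars L D.zeroFactor)
      (f' := extendScalars L D'.zeroFactor) (m := 1)
      (h := Polynomial.C (PowerSeries.map (algebraMap K L) D.unitSeries) *
        extendScalars L D.infiniteFactor * ∏ i, D.finiteFactor i)
      (h' := Polynomial.C (PowerSeries.map (algebraMap K L) D'.unitSeries) *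
        extendScalars L D'.infiniteFactor * ∏ i, D'.finiteFactor i)
      (by linear_combination heq) ?_ ?_ ?_ ?_
    · have ht : extendScalars L (tVar K) = tVar L := by simp [extendScalars, tVar]
      rw [← ht, ← map_sub, ← map_one (extendScalars (K := K) L), ← map_mul, ← map_mul, zeroFactor,
        zeroFactor, hd]
      congr 1
      ring
    · rw [reduction_zeroFactor, Polynomial.degree_X_pow]
      refine Polynomial.degree_map_le.trans_lt ((Polynomial.degree_sub_le _ _).trans_lt ?_)
      exact max_lt h.degree_R₂ (hd ▸ h'.degree_R₂)
    · rw [map_one]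
      exact isCoprime_one_right
    · rw [reduction_zeroFactor]
      refine isCoprime_X_pow ?_ _
      rw [map_mul, map_mul, reduction_C_map_unitSeries, reduction_infiniteFactor, map_prod,
        mul_one, Polynomial.coeff_C_mul]
      simp only [reduction_finiteFactor]
      rw [coeff_zero_prod_one_sub, mul_one]
      simpa using hc
  exact sub_eq_zero.1 ((map_eq_zero_iff _ (extendScalars_injective L)).1 hz)

/-- Here `m = u`. Modulo `t`, this and the complementary factor are coprime to `(1 - u/αᵢ)^{dᵢ}`,
since the `αᵢ` are distinct. -/
theorem Q_eq (h : D.IsFactorizationOf Δ) (h' : D'.IsFactorizationOf Δ) (hc : D.c ≠ 0)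
    {i : Fin D.k} {j : Fin D'.k} (hα : D.α i = D'.α j) (he : D.e i = D'.e j)
    (heq : Polynomial.C (PowerSeries.map (algebraMap K L) D.unitSeries) *
      extendScalars L D.infiniteFactor * extendScalars L D.zeroFactor * ∏ i, D.finiteFactor i =
      Polynomial.C (PowerSeries.map (algebraMap K L) D'.unitSeries) *
      extendScalars L D'.infiniteFactor * extendScalars L D'.zeroFactor *
        ∏ i, D'.finiteFactor i) : D.Q i = D'.Q j := by
  classical
  rw [← Finset.mul_prod_erase _ _ (Finset.mem_univ i),
    ← Finset.mul_prod_erase _ _ (Finset.mem_univ j), mul_left_comm _ (D.finiteFactor i),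
    mul_left_comm _ (D'.finiteFactor j)] at heq
  have hlin : IsCoprime (Polynomial.X : L[X]) (1 - Polynomial.C (D.α i)⁻¹ * Polynomial.X) :=
    ⟨Polynomial.C (D.α i)⁻¹, 1, by ring⟩
  refine sub_eq_zero.1 (eq_zero_of_mul_eq_mul (m := uVar L) heq ?_ ?_ ?_ ?_)
  · rw [finiteFactor, finiteFactor, hα, he]
    ring
  · have hne : (1 - Polynomial.C (D.α i)⁻¹ * Polynomial.X : L[X]) ^ D.e i ≠ 0 := by
      intro h0
      have := natDegree_one_sub_inv_mul_X_pow (h.α_ne_zero i) (D.e i)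
      rw [h0, Polynomial.natDegree_zero] at this
      exact (h.e_pos i).ne this
    rw [reduction_finiteFactor, Polynomial.degree_eq_natDegree hne,
      natDegree_one_sub_inv_mul_X_pow (h.α_ne_zero i)]
    exact (Polynomial.degree_sub_le _ _).trans_lt
      (max_lt (h.degree_Q i) (he ▸ h'.degree_Q j))
  · rw [reduction_finiteFactor, reduction_uVar]
    exact hlin.symm.pow_left
  · rw [reduction_finiteFactor]
    refine IsCoprime.pow_left ?_
    rw [map_mul, map_mul, map_mul, reduction_C_map_unitSeries, reduction_infiniteFactor,
      reduction_zeroFactor, map_prod, mul_one]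
    refine (IsCoprime.mul_right ?_ hlin.symm.pow_right).mul_right (IsCoprime.prod_right ?_)
    · have hu : IsUnit (Polynomial.C (algebraMap K L D.c)) :=
        Polynomial.isUnit_C.2 (IsUnit.mk0 _ (by simpa using hc))
      exact isCoprime_one_right.of_isCoprime_of_dvd_right hu.dvd
    · intro l hl
      rw [reduction_finiteFactor]
      exact (isCoprime_one_sub_inv_mul_X (h.α_ne_zero i) (h.α_ne_zero l)
        (h.α_injective.ne (Finset.ne_of_mem_erase hl).symm)).pow_right

theorem equivalent (h : D.IsFactorizationOf Δ) (h' : D'.IsFactorizationOf Δ) (hΔ : Δ ≠ 0) :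
    D.Equivalent D' := by
  have hc := h.c_ne_zero hΔ
  have hc' := h'.c_ne_zero hΔ
  have hred : ∀ D : FactorizationData K L,
      reduction L (Polynomial.C (PowerSeries.map (algebraMap K L) D.unitSeries) *
        extendScalars L D.infiniteFactor * extendScalars L D.zeroFactor *
          ∏ i, D.finiteFactor i) = Polynomial.C (algebraMap K L D.c) * Polynomial.X ^ D.d *
          ∏ i, (1 - Polynomial.C (D.α i)⁻¹ * Polynomial.X) ^ D.e i := by
    intro D
    rw [map_mul, map_mul, map_mul, reduction_C_map_unitSeries, reduction_infiniteFactor,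
      reduction_zeroFactor, map_prod, mul_one]
    simp only [reduction_finiteFactor]
  have hndvd : ∀ D : FactorizationData K L, D.c ≠ 0 →
      ¬ tVar L ∣ Polynomial.C (PowerSeries.map (algebraMap K L) D.unitSeries) *
        extendScalars L D.infiniteFactor * extendScalars L D.zeroFactor *
          ∏ i, D.finiteFactor i := by
    intro D hc
    rw [tVar_dvd_iff, hred]
    refine mul_ne_zero (mul_ne_zero (by simpa using hc)
      (pow_ne_zero _ Polynomial.X_ne_zero)) fun h0 => ?_
    have := coeff_zero_prod_one_sub Finset.univ D.α D.e
    rw [h0, Polynomial.coeff_zero] at this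
    exact zero_ne_one this
  obtain ⟨hp, heq⟩ := eq_of_pow_mul_eq_pow_mul tVar_ne_zero (hndvd D hc) (hndvd D' hc')
    (h.eq_tVar_pow_mul.symm.trans h'.eq_tVar_pow_mul)
  have hredeq := congrArg (reduction L) heq
  rw [hred, hred] at hredeq
  obtain ⟨hcc, hd, hprod⟩ := eq_of_C_mul_X_pow_mul_eq (by simpa using hc) (by simpa using hc')
    (coeff_zero_prod_one_sub _ _ _) (coeff_zero_prod_one_sub _ _ _) hredeq
  have hcc : D.c = D'.c := (algebraMap K L).injective hcc
  obtain ⟨σ, hσ⟩ := exists_equiv_of_prod_one_sub_eq h.α_ne_zero h'.α_ne_zero h.α_injective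
    h'.α_injective h.e_pos h'.e_pos hprod
  have hR₂ := h.R₂_eq h' hc hd heq
  have hQ : ∀ i, D.Q i = D'.Q (σ i) := fun i =>
    h.Q_eq h' hc (hσ i).1 (hσ i).2 heq
  have hZ : D.zeroFactor = D'.zeroFactor := by rw [zeroFactor, zeroFactor, hd, hR₂]
  have hF : ∏ i, D.finiteFactor i = ∏ i, D'.finiteFactor i := by
    rw [← Equiv.prod_comp σ]
    refine Finset.prod_congr rfl fun i _ => ?_
    rw [finiteFactor, finiteFactor, (hσ i).1, (hσ i).2, hQ i]
  have hne := h'.eq_tVar_pow_mul ▸ (map_ne_zero_iff _ (extendScalars_injective L)).2 hΔ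
  have hne := right_ne_zero_of_mul hne
  rw [hZ, hF] at heq
  have hCI := mul_right_cancel₀ (right_ne_zero_of_mul (left_ne_zero_of_mul hne))
    (mul_right_cancel₀ (right_ne_zero_of_mul hne) heq)
  -- The surviving factors have coefficients in `K[[t]]`, so injectivity of scalar extension brings
  -- the identity back over `K`.
  have hCI : Polynomial.C D.unitSeries * D.infiniteFactor =
      Polynomial.C D'.unitSeries * D'.infiniteFactor := by
    apply extendScalars_injective L
    rw [map_mul, map_mul]
    simpa [extendScalars] using hCI
  have hI0 : ∀ D : FactorizationData K L, D.infiniteFactor.coeff 0 = 1 := fun D => by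
    simp [infiniteFactor, Polynomial.coeff_zero_eq_eval_zero, uVar]
  -- The infinite factor is `1` at `u = 0`, so the constant term in `u` isolates `c(1 + tS)`.
  have hv : D.unitSeries = D'.unitSeries := by
    have := congrArg (fun q => Polynomial.coeff q 0) hCI
    simpa only [Polynomial.coeff_C_mul, hI0, mul_one] using this
  have hv0 : D'.unitSeries ≠ 0 := by
    intro h0
    have := congrArg PowerSeries.constantCoeff h0
    simp [unitSeries, hc'] at this
  have hI : D.infiniteFactor = D'.infiniteFactor := by
    rw [hv] at hCI
    exact mul_left_cancel₀ (Polynomial.C_ne_zero.2 hv0) hCI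
  refine ⟨hcc, hp, ?_, ?_, hd, hR₂, σ, fun i => ⟨(hσ i).1, (hσ i).2, hQ i⟩⟩
  · rw [unitSeries, unitSeries, hcc] at hv
    have hC : (PowerSeries.C D'.c : K⟦X⟧) ≠ 0 := by
      rw [Ne, map_eq_zero_iff _ PowerSeries.C_injective]
      exact hc'
    exact mul_left_cancel₀ PowerSeries.X_ne_zero (add_left_cancel (mul_left_cancel₀ hC hv))
  · rw [infiniteFactor, infiniteFactor] at hI
    exact mul_left_cancel₀ (mul_ne_zero tVar_ne_zero uVar_ne_zero) (add_left_cancel hI)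

end FactorizationData.IsFactorizationOf

theorem mainTheorem4 (K : Type*) [Field K] [CharZero K]
    (L : Type*) [Field L] [Algebra K L] [IsAlgClosure K L]
    (Δ : K⟦X⟧[X]) (hΔ : Δ ≠ 0) :
    (∃ D : FactorizationData K L, D.IsFactorizationOf Δ) ∧
    (∀ D D' : FactorizationData K L,
      D.IsFactorizationOf Δ → D'.IsFactorizationOf Δ → D.Equivalent D') ∧
    (∀ D : FactorizationData K L, D.IsFactorizationOf Δ →
      puiseuxRootsWith PuiseuxSeries.IsInfiniteAtZero (extendScalars L Δ) =
        puiseuxRoots (extendScalars L D.infiniteFactor) ∧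
      puiseuxRootsWith (PuiseuxSeries.IsEqualAtZero 0) (extendScalars L Δ) =
        puiseuxRoots (extendScalars L D.zeroFactor) ∧
      puiseuxRootsWith PuiseuxSeries.IsFiniteNonzeroAtZero (extendScalars L Δ) =
        puiseuxRoots (∏ i, D.finiteFactor i) ∧
      ∀ i, puiseuxRootsWith (PuiseuxSeries.IsEqualAtZero (D.α i)) (extendScalars L Δ) =
        puiseuxRoots (D.finiteFactor i)) := by
  have : IsAlgClosed L := IsAlgClosure.isAlgClosed K
  exact ⟨exists_isFactorizationOf K L Δ hΔ, fun _ _ h h' => h.equivalent h' hΔ,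
    fun _ h => h.puiseuxRoots_localization hΔ⟩
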